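/- Let $G$ be a group with a finite generating set $S$, acting by isometries on a geodesic metric space $(X,d)$ with a base point $x$. Write $(y\cdot z)_v=\frac12\big(d(y,v)+d(z,v)-d(y,z)\big)$ for the Gromov product, and suppose that for some real $\delta\ge 0$ the space $X$ is $\delta$-hyperbolic, that is, $(y\cdot z)_v\ge\min\{(y\cdot t)_v,(t\cdot z)_v\}-\delta$ for all $v,y,z,t\in X$. Let $G_x$ be the stabilizer of $x$ in $G$. For a set $A\subseteq G$ let $\Gamma(G,A)$ be the Cayley graph of $G$ with respect to $A$, in which $g$ and $ga$ are joined for $g\in G$, $a\in A$. Suppose that the action is (1) proper relative to $x$: there is a real number $\alpha$ such that $d(x,gx)>\alpha$ for all $g\in G\smallsetminus G_x$, and for every $N\in\mathbb{N}$ the set $B_N=\{g\in G\mid d(x,gx)\le N\}$ is bounded in $\Gamma(G,S\cup G_x)$; (2) regular, that is, it satisfies $(R2,k)$ for some $k\in\mathbb{N}$: for all $g,h\in G$ there is $u\in G$ such that $$d(x,ux)\le (gx\cdot hx)_x+k\delta,\qquad d(x,u^{-1}gx)\le (g^{-1}x\cdot g^{-1}hx)_x+k\delta,\qquad d(x,u^{-1}hx)\le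 (h^{-1}x\cdot h^{-1}gx)_x+k\delta.$$ Then $G$ is weakly hyperbolic relative to $G_x$: for every finite set $T\subseteq G$ such that $T\cup G_x$ generates $G$ (for instance $T=S$), the set $G$ with the path metric of the Cayley graph $\Gamma(G,T\cup G_x)$ is $\delta'$-hyperbolic for some $\delta'\ge 0$. (The constant $\alpha$ is not required to be positive; in particular the theorem covers the case $\alpha>0$.) -/

import Mathlib

namespace RelHyp

/-- The Gromov product `(y · z)_v = (d(y,v) + d(z,v) - d(y,z)) / 2` for a distance function `d`. -/
noncomputable def gromovProduct {X : Type*} (d : X → X → ℝ) (v y z : X) : ℝ :=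
  (d y v + d z v - d y z) / 2

/-- `δ`-hyperbolicity of a distance function, with respect to every base point. -/
def IsDeltaHyperbolic {X : Type*} (d : X → X → ℝ) (δ : ℝ) : Prop :=
  0 ≤ δ ∧ ∀ v y z t : X,
    min (gromovProduct d v y t) (gromovProduct d v t z) - δ ≤ gromovProduct d v y z

/-- A metric space is geodesic if any two points are the endpoints of a segment, that is, of an
isometrically embedded closed interval. -/
def IsGeodesicSpace (X : Type*) [MetricSpace X] : Prop :=
  ∀ y z : X, ∃ γ : ℝ → X, γ 0 = y ∧ γ (dist y z) = z ∧
    ∀ s ∈ Set.Icc 0 (dist y z), ∀ t ∈ Set.Icc 0 (dist y z), dist (γ s) (γ t) = |s - t|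

/-- The regularity condition `(R2, k)` for an action, read at the base point `x` and with the
hyperbolicity constant `δ`. -/
def RegularR2 (G : Type*) {X : Type*} [Group G] [MetricSpace X] [MulAction G X]
    (δ : ℝ) (x : X) (k : ℕ) : Prop :=
  ∀ g h : G, ∃ u : G,
    dist x (u • x) ≤ gromovProduct dist x (g • x) (h • x) + k * δ ∧
    dist x ((u⁻¹ * g) • x) ≤ gromovProduct dist x (g⁻¹ • x) ((g⁻¹ * h) • x) + k * δ ∧
    dist x ((u⁻¹ * h) • x) ≤ gromovProduct dist x (h⁻¹ • x) ((h⁻¹ * g) • x) + k * δ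

/-- The distance between two elements of `G` in the Cayley graph `Γ(G, A)` (the word metric; it is
a metric when `A` generates `G`). -/
noncomputable def cayleyDist {G : Type*} [Group G] (A : Set G) (g h : G) : ℝ :=
  ((SimpleGraph.mulCayley A).dist g h : ℝ)

/-- The action of `G` is proper relative to `x`, where `S` is a finite generating set of `G`:
the displacements `d(x, gx)` of the elements `g ∉ G_x` exceed some constant `α`, and every set
`B_N = {g | d(x, gx) ≤ N}` is bounded in the Cayley graph `Γ(G, S ∪ G_x)`. -/
def IsProperRelativeTo {G X : Type*} [Group G] [MetricSpace X] [MulAction G X]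
    (S : Set G) (x : X) : Prop :=
  (∃ α : ℝ, ∀ g : G, g ∉ MulAction.stabilizer G x → α < dist x (g • x)) ∧
  ∀ N : ℕ, ∃ (c : G) (R : ℝ), ∀ g : G, dist x (g • x) ≤ N →
    cayleyDist (S ∪ (MulAction.stabilizer G x : Set G)) c g ≤ R

/-- `G` is weakly hyperbolic relative to the subgroup `H`: `G` has a finite generating set relative
to `H`, and for every such set `S` the Cayley graph `Γ(G, S ∪ H)` is hyperbolic. -/
def IsWeaklyHyperbolicRelativeTo (G : Type*) [Group G] (H : Subgroup G) : Prop :=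
  (∃ S : Set G, S.Finite ∧ Subgroup.closure (S ∪ (H : Set G)) = ⊤) ∧
  ∀ S : Set G, S.Finite → Subgroup.closure (S ∪ (H : Set G)) = ⊤ →
    ∃ δ : ℝ, IsDeltaHyperbolic (cayleyDist (S ∪ (H : Set G))) δ

end RelHyp

/-!
Let `T` be a finite set that generates `G` together with `G_x`. The orbit map `g ↦ g x` is a
quasi-isometric embedding of the Cayley graph of `G` with respect to `T ∪ G_x` into the hyperbolic
space `X`, and a connected graph that embeds quasi-isometrically into
a geodesic hyperbolic space is hyperbolic.

*The embedding.* The orbit map is Lipschitz because elements of `G_x` do not move `x`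
(`exists_dist_smul_le_of_adj`). For the converse, join `1` to `g` by an edge path `h₀, …, hₙ` in the
Cayley graph of `S`. Regularity applied to `g` and `hᵢ` gives an orbit point near the point of the
segment `[x, g x]` at distance `(g x · hᵢ x)_x` from `x`. These distances grow from `0` to
`d(x, g x)` in bounded steps, so the whole segment lies near the orbit
(`exists_dist_smul_segment_le`). Walking along it from `x` to `g x`, one writes `g` as a product of
about `d(x, g x)` elements of bounded displacement, and these have bounded word length by relative
properness (`dist_mulCayley_le_dist_smul`).

*Hyperbolicity of the graph.* This rests on the stability of quasi-geodesics in `X`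
(`exists_dist_segment_quasiGeodesic_le`, `exists_gromovProduct_quasiGeodesic_le`). The needed
divergence estimate is obtained directly from the four-point inequality by bisecting a path
(`IsDeltaHyperbolic.gromovProduct_chain`). Stability shows that geodesic triangles of the graph are
slim, and slim triangles give the four-point inequality (`IsSlim.isDeltaHyperbolic`).
-/

namespace RelHyp

open Set

/-! ### Gromov products -/

theorem gromovProduct_comm {X : Type*} [PseudoMetricSpace X] (v y z : X) :
    gromovProduct dist v y z = gromovProduct dist v z y := by
  simp only [gromovProduct, dist_comm y z]
  ring

theorem gromovProduct_self {X : Type*} [PseudoMetricSpace X] (v y : X) :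
    gromovProduct dist v y y = dist y v := by
  simp [gromovProduct]

theorem le_gromovProduct_of_dist_le {X : Type*} [PseudoMetricSpace X] {v y z : X} {D M : ℝ}
    (hy : D ≤ dist y v) (hz : D ≤ dist z v) (hM : 0 ≤ M) (hyz : dist y z ≤ M) :
    D - M ≤ gromovProduct dist v y z := by
  unfold gromovProduct
  linarith

/-- The loss is only logarithmic in the length of the chain: bisecting it costs one `δ` for each of
`k` rounds. -/
theorem IsDeltaHyperbolic.gromovProduct_chain {Y : Type*} {d : Y → Y → ℝ} {δ : ℝ}
    (h : IsDeltaHyperbolic d δ) (v : Y) {m : ℝ} (k : ℕ) (y : ℕ → Y) (n : ℕ) (hn : 1 ≤ n)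
    (hk : n ≤ 2 ^ k) (hm : ∀ i < n, m ≤ gromovProduct d v (y i) (y (i + 1))) :
    m - k * δ ≤ gromovProduct d v (y 0) (y n) := by
  induction k generalizing y n with
  | zero =>
    obtain rfl : n = 1 := by simp at hk; omega
    simpa using hm 0 one_pos
  | succ k ih =>
    have h0 := h.1
    push_cast
    rcases le_or_gt n (2 ^ k) with hle | hlt
    · have := ih y n hn hle hm
      linarith
    · have h1 := ih y (2 ^ k) Nat.one_le_two_pow le_rfl (fun i hi => hm i (hi.trans hlt))
      have h2 := ih (fun i => y (2 ^ k + i)) (n - 2 ^ k) (by omega)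
        (by rw [pow_succ] at hk; omega) (fun i hi => hm (2 ^ k + i) (by omega))
      simp only [Nat.add_zero, Nat.add_sub_cancel' hlt.le] at h2
      have h3 := h.2 v (y 0) (y n) (y (2 ^ k))
      have h4 := le_min h1 h2
      linarith

/-- A path with steps at most `M` that stays at distance at least `D` from `v` has endpoints whose
Gromov product at `v` is almost `D`, up to a logarithm of the number of steps. -/
theorem IsDeltaHyperbolic.le_gromovProduct_of_path {X : Type*} [PseudoMetricSpace X] {δ : ℝ}
    (h : IsDeltaHyperbolic (dist : X → X → ℝ) δ) {v : X} {D M : ℝ} (hM : 0 ≤ M) {y : ℕ → X} {n : ℕ}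
    (hy : ∀ i < n, dist (y i) (y (i + 1)) ≤ M) (hD : ∀ i ≤ n, D ≤ dist (y i) v)
    {i j k : ℕ} (hi : i ≤ n) (hj : j ≤ n) (hij : i ≤ j + 2 ^ k) (hji : j ≤ i + 2 ^ k) :
    D - M - k * δ ≤ gromovProduct dist v (y i) (y j) := by
  have h0 : 0 ≤ (k : ℝ) * δ := mul_nonneg k.cast_nonneg h.1
  wlog hlt : i ≤ j generalizing i j
  · rw [gromovProduct_comm]
    exact this hj hi hji hij (by omega)
  rcases hlt.eq_or_lt with rfl | hlt
  · rw [gromovProduct_self]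
    have := hD i hi
    linarith
  · have := h.gromovProduct_chain v (m := D - M) k (fun l => y (i + l)) (j - i) (by omega)
      (by omega) (fun l hl => le_gromovProduct_of_dist_le (hD _ (by omega)) (hD _ (by omega)) hM
        (hy (i + l) (by omega)))
    simpa [Nat.add_sub_cancel' hlt.le] using this

/-- If `v` lies on a geodesic from `a` to `c`, and `y` is at most `E` farther than `v` from each of
`a` and `c`, then `y` is close to `v`. -/
theorem IsDeltaHyperbolic.dist_le_of_between {X : Type*} [PseudoMetricSpace X] {δ : ℝ}
    (h : IsDeltaHyperbolic (dist : X → X → ℝ) δ) {a c v y : X} {E : ℝ}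
    (hv : dist a v + dist v c = dist a c) (ha : dist a y ≤ dist a v + E)
    (hc : dist y c ≤ dist v c + E) : dist y v ≤ E + 2 * δ := by
  have h1 := h.2 v a c y
  have h2 : gromovProduct dist v a c = 0 := by
    simp only [gromovProduct, dist_comm c v]
    linarith
  rw [h2] at h1
  rcases min_le_iff.1 (sub_nonpos.1 h1) with h3 | h3 <;> simp only [gromovProduct] at h3
  · linarith
  · rw [dist_comm v c] at hc
    linarith

theorem exists_nat_bound_of_two_pow_le (A B : ℝ) :
    ∃ K : ℕ, ∀ k : ℕ, (2 : ℝ) ^ k ≤ A + B * k → k ≤ K := by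
  have h1 := tendsto_pow_const_div_const_pow_of_one_lt 1 (one_lt_two (α := ℝ))
  have h0 := tendsto_pow_const_div_const_pow_of_one_lt 0 (one_lt_two (α := ℝ))
  have h2 := (h0.const_mul A).add (h1.const_mul B)
  simp only [mul_zero, add_zero] at h2
  obtain ⟨K, hK⟩ := Filter.eventually_atTop.1 (h2.eventually_lt_const one_pos)
  refine ⟨K, fun k hk => ?_⟩
  by_contra! hlt
  have h3 := hK k hlt.le
  have h4 : (0 : ℝ) < 2 ^ k := by positivity
  rw [← mul_div_assoc, ← mul_div_assoc, ← add_div, div_lt_one h4] at h3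
  simp only [pow_zero, pow_one, mul_one] at h3
  linarith

/-! ### Stability of quasi-geodesics -/

/-- The points `y 0, …, y n` form a discrete quasi-geodesic: the steps have length at most `M`, and
`|i - j| ≤ A d(y i, y j) + A`. The absolute value is avoided: `le_dist` applies to `(i, j)` and to
`(j, i)`. -/
structure IsQuasiGeodesic {X : Type*} [PseudoMetricSpace X] (M A : ℝ) (y : ℕ → X) (n : ℕ) :
    Prop where
  step : ∀ i < n, dist (y i) (y (i + 1)) ≤ M
  le_dist : ∀ i ≤ n, ∀ j ≤ n, (i : ℝ) ≤ j + (A * dist (y i) (y j) + A)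

/-- `γ` restricted to `[0, dist a b]` is a geodesic segment from `a` to `b`. -/
structure IsSegment {X : Type*} [PseudoMetricSpace X] (γ : ℝ → X) (a b : X) : Prop where
  left : γ 0 = a
  right : γ (dist a b) = b
  dist_eq : ∀ s ∈ Icc 0 (dist a b), ∀ t ∈ Icc 0 (dist a b), dist (γ s) (γ t) = |s - t|

namespace IsSegment

variable {X : Type*} [PseudoMetricSpace X] {γ : ℝ → X} {a b : X}

theorem continuousOn (h : IsSegment γ a b) : ContinuousOn γ (Icc 0 (dist a b)) := by
  refine LipschitzOnWith.continuousOn (K := 1) (LipschitzOnWith.of_dist_le_mul fun s hs t ht => ?_)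
  rw [h.dist_eq s hs t ht, Real.dist_eq]
  simp

theorem dist_left (h : IsSegment γ a b) {t : ℝ} (ht : t ∈ Icc 0 (dist a b)) :
    dist a (γ t) = t := by
  have := h.dist_eq 0 ⟨le_rfl, dist_nonneg⟩ t ht
  rw [h.left] at this
  rw [this, zero_sub, abs_neg, abs_of_nonneg ht.1]

theorem dist_right (h : IsSegment γ a b) {t : ℝ} (ht : t ∈ Icc 0 (dist a b)) :
    dist (γ t) b = dist a b - t := by
  have := h.dist_eq t ht (dist a b) ⟨dist_nonneg, le_rfl⟩
  rw [h.right] at this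
  rw [this, abs_sub_comm, abs_of_nonneg (sub_nonneg.2 ht.2)]

theorem gromovProduct_eq_zero (h : IsSegment γ a b) {s t u : ℝ} (hs : s ∈ Icc 0 (dist a b))
    (hu : u ∈ Icc 0 (dist a b)) (hst : s ≤ t) (htu : t ≤ u) :
    gromovProduct dist (γ t) (γ s) (γ u) = 0 := by
  have ht : t ∈ Icc 0 (dist a b) := ⟨hs.1.trans hst, htu.trans hu.2⟩
  rw [gromovProduct, h.dist_eq s hs t ht, h.dist_eq u hu t ht, h.dist_eq s hs u hu,
    abs_sub_comm s, abs_sub_comm s, abs_of_nonneg (by linarith), abs_of_nonneg (by linarith),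
    abs_of_nonneg (by linarith)]
  ring

/-- In a hyperbolic space, a point with `(a · b)_y ≤ E` lies near every geodesic from `a` to `b`. -/
theorem exists_dist_le (h : IsSegment γ a b) {δ E : ℝ}
    (hX : IsDeltaHyperbolic (dist : X → X → ℝ) δ) {y : X} (hy : gromovProduct dist y a b ≤ E) :
    ∃ t ∈ Icc 0 (dist a b), dist y (γ t) ≤ E + 2 * δ := by
  have ht : gromovProduct dist a y b ∈ Icc 0 (dist a b) := by
    have h1 := dist_triangle y a b
    have h2 := dist_triangle a b y
    simp only [gromovProduct, mem_Icc]
    constructor <;> linarith [dist_comm y a, dist_comm y b, dist_comm a b]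
  refine ⟨_, ht, hX.dist_le_of_between (a := a) (c := b) ?_ ?_ ?_⟩
  · rw [h.dist_left ht, h.dist_right ht]
    ring
  · rw [h.dist_left ht]
    simp only [gromovProduct] at *
    linarith [dist_comm a y, dist_comm b y, dist_comm a b]
  · rw [h.dist_right ht]
    simp only [gromovProduct] at *
    linarith [dist_comm a y, dist_comm b y, dist_comm a b]

end IsSegment

/-- A geodesic stays near a quasi-geodesic with the same endpoints. At the point `γ t` of the
geodesic farthest from the quasi-geodesic, at distance `D`, one cuts the geodesic at distance `2 D`
on both sides and closes up by a piece of the quasi-geodesic. That piece has `O(D)` steps and avoids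
the ball of radius `D`, so `D = O(log D)`. -/
theorem exists_dist_segment_quasiGeodesic_le {X : Type*} [PseudoMetricSpace X] {δ : ℝ}
    (hX : IsDeltaHyperbolic (dist : X → X → ℝ) δ) {M A : ℝ} (hM : 0 ≤ M) (hA : 0 ≤ A) :
    ∃ D : ℝ, 0 ≤ D ∧ ∀ (y : ℕ → X) (n : ℕ) (γ : ℝ → X), IsQuasiGeodesic M A y n →
      IsSegment γ (y 0) (y n) →
      ∀ t ∈ Icc 0 (dist (y 0) (y n)), ∃ i ≤ n, dist (y i) (γ t) ≤ D := by
  have hδ := hX.1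
  obtain ⟨K, hK⟩ := exists_nat_bound_of_two_pow_le (A * (6 * (M + 3 * δ)) + A + 1) (A * (6 * δ))
  refine ⟨M + (K + 3) * δ, by positivity, fun y n γ hy hγ => ?_⟩
  set I := Icc 0 (dist (y 0) (y n)) with hI
  set Y : Set X := y '' Iic n with hY
  have hYc : IsCompact Y := ((finite_Iic n).image y).isCompact
  have hYn : Y.Nonempty := ⟨y 0, 0, Nat.zero_le _, rfl⟩
  have hcont : ContinuousOn (fun t => Metric.infDist (γ t) Y) I :=
    (Metric.continuous_infDist_pt Y).comp_continuousOn hγ.continuousOn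
  have near : ∀ v, ∃ i ≤ n, Metric.infDist v Y = dist (y i) v := fun v => by
    obtain ⟨_, ⟨i, hi, rfl⟩, h⟩ := hYc.exists_infDist_eq_dist hYn v
    exact ⟨i, hi, by rw [h, dist_comm]⟩
  obtain ⟨t, ht, hmax⟩ := isCompact_Icc.exists_isMaxOn (s := I) ⟨0, le_rfl, dist_nonneg⟩ hcont
  set D := Metric.infDist (γ t) Y with hD
  have hD0 : 0 ≤ D := Metric.infDist_nonneg
  have hle : ∀ s ∈ I, Metric.infDist (γ s) Y ≤ D := fun s hs => hmax hs
  have hfar : ∀ i ≤ n, D ≤ dist (y i) (γ t) := fun i hi => by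
    rw [dist_comm]
    exact Metric.infDist_le_dist_of_mem ⟨i, hi, rfl⟩
  suffices hDK : D ≤ M + (K + 3) * δ by
    intro s hs
    obtain ⟨i, hi, h⟩ := near (γ s)
    exact ⟨i, hi, h ▸ (hle s hs).trans hDK⟩
  -- At a cut point `γ s`, the chord to a nearest point of the quasi-geodesic stays far from `γ t`.
  -- If `γ s` is an endpoint of the geodesic, the chord is trivial.
  have cut : ∀ s ∈ I, |s - t| = 2 * D ∨ s = 0 ∨ s = dist (y 0) (y n) →
      ∃ i ≤ n, dist (y i) (γ s) ≤ D ∧ D ≤ gromovProduct dist (γ t) (γ s) (y i) := by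
    rintro s hs (h | rfl | rfl)
    · obtain ⟨i, hi, h'⟩ := near (γ s)
      have h1 := hle s hs
      refine ⟨i, hi, h' ▸ h1, ?_⟩
      have h2 := hfar i hi
      rw [gromovProduct, hγ.dist_eq s hs t ht, h, dist_comm (γ s)]
      linarith
    · refine ⟨0, Nat.zero_le _, ?_, ?_⟩
      · rw [hγ.left, dist_self]
        exact hD0
      · rw [hγ.left, gromovProduct_self]
        exact hfar 0 (Nat.zero_le _)
    · refine ⟨n, le_rfl, ?_, ?_⟩
      · rw [hγ.right, dist_self]
        exact hD0
      · rw [hγ.right, gromovProduct_self]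
        exact hfar n le_rfl
  have hs₁ : ∃ s ∈ I, s ≤ t ∧ t - s ≤ 2 * D ∧
      (|s - t| = 2 * D ∨ s = 0 ∨ s = dist (y 0) (y n)) := by
    rcases le_or_gt (2 * D) t with h | h
    · refine ⟨t - 2 * D, ⟨by linarith, by linarith [ht.2]⟩, by linarith, by linarith, Or.inl ?_⟩
      rw [abs_sub_comm, abs_of_nonneg] <;> linarith
    · exact ⟨0, ⟨le_rfl, dist_nonneg⟩, ht.1, by linarith, Or.inr (Or.inl rfl)⟩
  have hs₂ : ∃ s ∈ I, t ≤ s ∧ s - t ≤ 2 * D ∧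
      (|s - t| = 2 * D ∨ s = 0 ∨ s = dist (y 0) (y n)) := by
    rcases le_or_gt (t + 2 * D) (dist (y 0) (y n)) with h | h
    · refine ⟨t + 2 * D, ⟨by linarith [ht.1], h⟩, by linarith, by linarith, Or.inl ?_⟩
      rw [abs_of_nonneg] <;> linarith
    · exact ⟨_, ⟨dist_nonneg, le_rfl⟩, ht.2, by linarith, Or.inr (Or.inr rfl)⟩
  obtain ⟨s₁, hs₁, hs₁t, hd₁, hc₁⟩ := hs₁
  obtain ⟨s₂, hs₂, hts₂, hd₂, hc₂⟩ := hs₂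
  obtain ⟨i, hi, hi1, hi2⟩ := cut s₁ hs₁ hc₁
  obtain ⟨j, hj, hj1, hj2⟩ := cut s₂ hs₂ hc₂
  have hij : dist (y i) (y j) ≤ 6 * D := by
    have h1 := dist_triangle4 (y i) (γ s₁) (γ s₂) (y j)
    rw [hγ.dist_eq s₁ hs₁ s₂ hs₂, abs_sub_comm, abs_of_nonneg (by linarith),
      dist_comm (γ s₂)] at h1
    linarith
  set N : ℕ := i - j + (j - i) with hN
  have hNle : (N : ℝ) ≤ A * (6 * D) + A := by
    have h0 := mul_le_mul_of_nonneg_left hij hA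
    rcases le_total i j with h | h
    · have h1 := hy.le_dist j hj i hi
      rw [dist_comm] at h1
      rw [hN, Nat.sub_eq_zero_of_le h, zero_add, Nat.cast_sub h]
      linarith
    · have h1 := hy.le_dist i hi j hj
      rw [hN, Nat.sub_eq_zero_of_le h, add_zero, Nat.cast_sub h]
      linarith
  -- `2 ^ k` is bounded by `N + 1`, hence linearly in `D`, while `D` is bounded linearly in `k`
  set k := Nat.log 2 (N + 1) with hk
  have hk1 : 2 ^ k ≤ N + 1 := Nat.pow_log_le_self 2 (Nat.succ_ne_zero N)
  have hk2 : N + 1 < 2 ^ (k + 1) := Nat.lt_pow_succ_log_self one_lt_two _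
  have hprod := hX.le_gromovProduct_of_path hM hy.step hfar hi hj
    (k := k + 1) (by omega) (by omega)
  have hDk : D ≤ M + (k + 3) * δ := by
    have h1 := hX.2 (γ t) (γ s₁) (γ s₂) (y i)
    have h2 := hX.2 (γ t) (y i) (γ s₂) (y j)
    rw [hγ.gromovProduct_eq_zero hs₁ hs₂ hs₁t hts₂] at h1
    rw [gromovProduct_comm] at hj2
    push_cast at hprod
    have h0 : 0 ≤ (k : ℝ) * δ := by positivity
    have h3 : D - M - (k + 1) * δ ≤ min (gromovProduct dist (γ t) (y i) (y j))
        (gromovProduct dist (γ t) (y j) (γ s₂)) := le_min hprod (by linarith)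
    have h4 : D - M - (k + 2) * δ ≤ min (gromovProduct dist (γ t) (γ s₁) (y i))
        (gromovProduct dist (γ t) (y i) (γ s₂)) := le_min (by linarith) (by linarith)
    linarith
  have hkK : (k : ℝ) ≤ K := by
    refine Nat.cast_le.2 (hK k ?_)
    have h1 : (2 : ℝ) ^ k ≤ N + 1 := by exact_mod_cast hk1
    have h2 := mul_le_mul_of_nonneg_left hDk hA
    linarith
  have := mul_le_mul_of_nonneg_right hkK hδ
  linarith

/-- A quasi-geodesic stays near the geodesics with the same endpoints. By connectedness, some point
of the geodesic is close both to a point before `y i` and to a point after `y i`; the indices of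
these two are then close. -/
theorem exists_gromovProduct_quasiGeodesic_le {X : Type*} [PseudoMetricSpace X] {δ : ℝ}
    (hX : IsDeltaHyperbolic (dist : X → X → ℝ) δ) {M A : ℝ} (hM : 0 ≤ M) (hA : 0 ≤ A) :
    ∃ D : ℝ, 0 ≤ D ∧ ∀ (y : ℕ → X) (n : ℕ) (γ : ℝ → X), IsQuasiGeodesic M A y n →
      IsSegment γ (y 0) (y n) → ∀ i ≤ n, gromovProduct dist (y i) (y 0) (y n) ≤ D := by
  obtain ⟨D, hD0, hD⟩ := exists_dist_segment_quasiGeodesic_le hX hM hA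
  refine ⟨M * (A * (2 * D) + A) + D, by positivity, fun y n γ hy hγ i hi => ?_⟩
  set I := Icc 0 (dist (y 0) (y n)) with hI
  have hclosed : ∀ s : Set ℕ, s.Finite →
      IsClosed (I ∩ ⋃ j ∈ s, (fun t => dist (y j) (γ t)) ⁻¹' Iic D) := fun s hs => by
    simp only [inter_iUnion]
    exact hs.isClosed_biUnion fun j _ =>
      ((continuous_const.dist continuous_id).comp_continuousOn
        hγ.continuousOn).preimage_isClosed_of_isClosed isClosed_Icc isClosed_Iic
  obtain ⟨t, ht, ht1, ht2⟩ := isPreconnected_closed_iff.1 (isPreconnected_Icc (a := (0 : ℝ))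
    (b := dist (y 0) (y n))) _ _ (hclosed (Icc 0 i) (finite_Icc _ _))
    (hclosed (Icc i n) (finite_Icc _ _))
    (fun t ht => by
      obtain ⟨j, hj, h⟩ := hD y n γ hy hγ t ht
      rcases le_total j i with hji | hij
      · exact Or.inl ⟨ht, mem_biUnion (⟨Nat.zero_le _, hji⟩ : j ∈ Icc 0 i) h⟩
      · exact Or.inr ⟨ht, mem_biUnion (⟨hij, hj⟩ : j ∈ Icc i n) h⟩)
    ⟨0, ⟨le_rfl, dist_nonneg⟩, ⟨le_rfl, dist_nonneg⟩,
      mem_biUnion (⟨le_rfl, Nat.zero_le _⟩ : 0 ∈ Icc 0 i) (by simpa [hγ.left] using hD0)⟩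
    ⟨dist (y 0) (y n), ⟨dist_nonneg, le_rfl⟩, ⟨dist_nonneg, le_rfl⟩,
      mem_biUnion (⟨hi, le_rfl⟩ : n ∈ Icc i n) (by simpa [hγ.right] using hD0)⟩
  obtain ⟨-, h1⟩ := ht1
  obtain ⟨-, h2⟩ := ht2
  simp only [mem_iUnion, mem_preimage, mem_Iic] at h1 h2
  obtain ⟨j, ⟨-, hji⟩, hj⟩ := h1
  obtain ⟨l, ⟨hil, hln⟩, hl⟩ := h2
  have hjl : dist (y l) (y j) ≤ 2 * D := by
    have := dist_triangle_right (y l) (y j) (γ t)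
    linarith
  have hidx := hy.le_dist l hln j (hji.trans hi)
  have hpath : dist (y j) (y i) ≤ M * (i - j) := by
    have := dist_le_Ico_sum_of_dist_le (f := y) hji (d := fun _ => M)
      (fun {m} _ hm => hy.step m (hm.trans_le hi))
    rw [Finset.sum_const, Nat.card_Ico, nsmul_eq_mul, Nat.cast_sub hji] at this
    linarith
  have hgap : ((i : ℝ) - j) ≤ A * (2 * D) + A := by
    have h3 : (i : ℝ) ≤ l := Nat.cast_le.2 hil
    have h4 := mul_le_mul_of_nonneg_left hjl hA
    linarith
  have h5 := mul_le_mul_of_nonneg_left hgap hM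
  have h6 : dist (y i) (γ t) ≤ M * (A * (2 * D) + A) + D := by
    have := dist_triangle (y i) (y j) (γ t)
    linarith [dist_comm (y i) (y j)]
  have h7 := dist_triangle_right (y 0) (y i) (γ t)
  have h8 := dist_triangle (y n) (γ t) (y i)
  have h9 := hγ.dist_left ht
  have h10 := hγ.dist_right ht
  simp only [gromovProduct]
  linarith [dist_comm (γ t) (y i), dist_comm (y n) (γ t)]

/-! ### Hyperbolic graphs -/

theorem exists_geodesic_through {V : Type*} {Γ : SimpleGraph V} (hΓ : Γ.Connected) {a z b : V}
    (h : Γ.dist a z + Γ.dist z b = Γ.dist a b) :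
    ∃ p : ℕ → V, p 0 = a ∧ p (Γ.dist a z) = z ∧ p (Γ.dist a b) = b ∧
      ∀ i < Γ.dist a b, Γ.Adj (p i) (p (i + 1)) := by
  obtain ⟨w₁, h₁⟩ := hΓ.exists_walk_length_eq_dist a z
  obtain ⟨w₂, h₂⟩ := hΓ.exists_walk_length_eq_dist z b
  have hw : (w₁.append w₂).length = Γ.dist a b := by
    rw [SimpleGraph.Walk.length_append, h₁, h₂, h]
  refine ⟨(w₁.append w₂).getVert, SimpleGraph.Walk.getVert_zero _, ?_, ?_, fun i hi =>
    SimpleGraph.Walk.adj_getVert_succ _ (hw ▸ hi)⟩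
  · simp [SimpleGraph.Walk.getVert_append, h₁]
  · rw [← hw, SimpleGraph.Walk.getVert_length]

theorem dist_le_sub_of_adj {V : Type*} {Γ : SimpleGraph V} (hΓ : Γ.Connected) {p : ℕ → V} {n : ℕ}
    (hp : ∀ i < n, Γ.Adj (p i) (p (i + 1))) {i j : ℕ} (hij : i ≤ j) (hj : j ≤ n) :
    Γ.dist (p i) (p j) ≤ j - i := by
  induction j, hij using Nat.le_induction with
  | base => simp
  | succ j hij ih =>
    have h1 := ih (by omega)
    have h2 := hΓ.dist_triangle (u := p i) (v := p j) (w := p (j + 1))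
    rw [SimpleGraph.dist_eq_one_iff_adj.2 (hp j (by omega))] at h2
    omega

/-- An edge path whose length is the distance of its endpoints is isometrically embedded. -/
theorem dist_eq_sub_of_adj {V : Type*} {Γ : SimpleGraph V} (hΓ : Γ.Connected) {p : ℕ → V} {n : ℕ}
    (hp : ∀ i < n, Γ.Adj (p i) (p (i + 1))) (hn : Γ.dist (p 0) (p n) = n) {i j : ℕ} (hij : i ≤ j)
    (hj : j ≤ n) : Γ.dist (p i) (p j) = j - i := by
  have h1 := dist_le_sub_of_adj hΓ hp hij hj
  have h2 := dist_le_sub_of_adj hΓ hp (Nat.zero_le i) (hij.trans hj)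
  have h3 := dist_le_sub_of_adj hΓ hp hj le_rfl
  have h4 := hΓ.dist_triangle (u := p 0) (v := p i) (w := p n)
  have h5 := hΓ.dist_triangle (u := p i) (v := p j) (w := p n)
  omega

/-- Geodesic triangles of the graph `Γ` are `D`-slim. A vertex `z` lies on a geodesic from `a` to
`b` iff `d(a,z) + d(z,b) = d(a,b)`, so that geodesics need not be mentioned. -/
def IsSlim {V : Type*} (Γ : SimpleGraph V) (D : ℕ) : Prop :=
  ∀ a b c z : V, Γ.dist a z + Γ.dist z b = Γ.dist a b → ∃ q, Γ.dist z q ≤ D ∧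
    (Γ.dist a q + Γ.dist q c = Γ.dist a c ∨ Γ.dist c q + Γ.dist q b = Γ.dist c b)

/-- Between `a` and `b` there is a vertex whose distance to `w` is almost `(a · b)_w`: it is found
where the geodesic from `a` to `b` passes from the neighbourhood of the side `[a, w]` of the
triangle to that of the side `[w, b]`. -/
theorem IsSlim.exists_dist_le_gromovProduct {V : Type*} {Γ : SimpleGraph V} (hΓ : Γ.Connected)
    {D : ℕ} (h : IsSlim Γ D) (a b w : V) :
    ∃ z, Γ.dist a z + Γ.dist z b = Γ.dist a b ∧
      2 * Γ.dist w z + Γ.dist a b ≤ Γ.dist a w + Γ.dist b w + (4 * D + 4) := by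
  obtain ⟨p, hp0, -, hpn, hp⟩ :=
    exists_geodesic_through hΓ (a := a) (z := a) (b := b) (by simp)
  set n := Γ.dist a b with hn
  have hbt : ∀ i ≤ n, Γ.dist a (p i) + Γ.dist (p i) b = n := fun i hi => by
    have h1 := dist_eq_sub_of_adj hΓ hp (by rw [hp0, hpn]) (Nat.zero_le i) hi
    have h2 := dist_eq_sub_of_adj hΓ hp (by rw [hp0, hpn]) hi le_rfl
    rw [hp0] at h1
    rw [hpn] at h2
    omega
  -- `P i`: the vertex `p i` is near the side `[a, w]`
  let P : ℕ → Prop := fun i => ∃ q, Γ.dist (p i) q ≤ D ∧ Γ.dist a q + Γ.dist q w = Γ.dist a w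
  have key : ∃ i ≤ n, P i ∧ ∃ r, Γ.dist (p i) r ≤ D + 1 ∧
      Γ.dist w r + Γ.dist r b = Γ.dist w b := by
    by_contra! hcon
    have hall : ∀ i ≤ n, P i := by
      intro i
      induction i with
      | zero => exact fun _ => ⟨a, by simp [hp0], by simp⟩
      | succ i ih =>
        intro hi
        obtain ⟨r, hr, hr' | hr'⟩ := h a b w (p (i + 1)) (hbt _ hi)
        · exact ⟨r, hr, hr'⟩
        · have h1 := hΓ.dist_triangle (u := p i) (v := p (i + 1)) (w := r)
          rw [SimpleGraph.dist_eq_one_iff_adj.2 (hp i (by omega))] at h1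
          exact absurd hr' (hcon i (by omega) (ih (by omega)) r (by omega))
    exact hcon n le_rfl (hall n le_rfl) b (by simp [hpn]) (by simp)
  obtain ⟨i, hi, ⟨q, hq, hq'⟩, r, hr, hr'⟩ := key
  refine ⟨p i, hbt i hi, ?_⟩
  have h1 := hΓ.dist_triangle (u := a) (v := q) (w := p i)
  have h2 := hΓ.dist_triangle (u := w) (v := q) (w := p i)
  have h3 := hΓ.dist_triangle (u := w) (v := r) (w := p i)
  have h4 := hΓ.dist_triangle (u := p i) (v := r) (w := b)
  have h5 := hbt i hi
  rw [Γ.dist_comm (u := q) (v := p i)] at h1 h2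
  rw [Γ.dist_comm (u := r) (v := p i)] at h3
  rw [Γ.dist_comm (u := w) (v := q)] at h2
  rw [Γ.dist_comm (u := b) (v := w)]
  omega

theorem IsSlim.isDeltaHyperbolic {V : Type*} {Γ : SimpleGraph V} (hΓ : Γ.Connected)
    {D : ℕ} (h : IsSlim Γ D) :
    IsDeltaHyperbolic (fun u v => (Γ.dist u v : ℝ)) (3 * D + 2) := by
  refine ⟨by positivity, fun v y z t => ?_⟩
  obtain ⟨m, hm, hm'⟩ := h.exists_dist_le_gromovProduct hΓ y z v
  obtain ⟨q, hq, hq'⟩ := h y z t m hm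
  have h1 := hΓ.dist_triangle (u := v) (v := m) (w := q)
  have h1' : (Γ.dist v q : ℝ) ≤ Γ.dist v m + D := by exact_mod_cast h1.trans (by omega)
  have hm'' : 2 * (Γ.dist v m : ℝ) + Γ.dist y z ≤ Γ.dist y v + Γ.dist z v + (4 * D + 4) := by
    exact_mod_cast hm'
  rw [sub_le_iff_le_add, min_le_iff]
  refine hq'.imp (fun hq' => ?_) (fun hq' => ?_)
  · have h2 := hΓ.dist_triangle (u := y) (v := q) (w := v)
    have h3 := hΓ.dist_triangle (u := t) (v := q) (w := v)
    rw [Γ.dist_comm (u := q) (v := v)] at h2 h3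
    rw [Γ.dist_comm (u := t) (v := q)] at h3
    have h4 : (Γ.dist y v + Γ.dist t v : ℝ) ≤ Γ.dist y t + 2 * Γ.dist v q := by
      exact_mod_cast (by omega)
    simp only [gromovProduct]
    linarith
  · have h2 := hΓ.dist_triangle (u := t) (v := q) (w := v)
    have h3 := hΓ.dist_triangle (u := z) (v := q) (w := v)
    rw [Γ.dist_comm (u := q) (v := v)] at h2 h3
    rw [Γ.dist_comm (u := z) (v := q)] at h3
    have h4 : (Γ.dist t v + Γ.dist z v : ℝ) ≤ Γ.dist t z + 2 * Γ.dist v q := by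
      exact_mod_cast (by omega)
    simp only [gromovProduct]
    linarith

theorem IsGeodesicSpace.exists_isSegment {X : Type*} [MetricSpace X] (h : IsGeodesicSpace X)
    (a b : X) : ∃ γ : ℝ → X, IsSegment γ a b :=
  let ⟨γ, h0, h1, h2⟩ := h a b
  ⟨γ, h0, h1, h2⟩

/-- A connected graph that embeds quasi-isometrically into a geodesic hyperbolic space is
hyperbolic. Geodesics of the graph become quasi-geodesics, so slimness of triangles is inherited
from the space by stability of quasi-geodesics. -/
theorem exists_isDeltaHyperbolic_of_quasiIsometry {V X : Type*} [MetricSpace X]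
    {Γ : SimpleGraph V} (hΓ : Γ.Connected) (hgeo : IsGeodesicSpace X) {δ : ℝ}
    (hX : IsDeltaHyperbolic (dist : X → X → ℝ) δ) (f : V → X) {M A : ℝ} (hM : 0 ≤ M) (hA : 0 ≤ A)
    (hf : ∀ u v, Γ.Adj u v → dist (f u) (f v) ≤ M)
    (hf' : ∀ u v, (Γ.dist u v : ℝ) ≤ A * dist (f u) (f v) + A) :
    ∃ δ' : ℝ, IsDeltaHyperbolic (fun u v => (Γ.dist u v : ℝ)) δ' := by
  have hδ := hX.1
  obtain ⟨D₁, hD₁, h₁⟩ := exists_dist_segment_quasiGeodesic_le hX hM hA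
  obtain ⟨D₂, hD₂, h₂⟩ := exists_gromovProduct_quasiGeodesic_le hX hM hA
  -- the image of a geodesic of `Γ` through `z`
  have path : ∀ a z b, Γ.dist a z + Γ.dist z b = Γ.dist a b → ∃ p : ℕ → V, p 0 = a ∧
      p (Γ.dist a z) = z ∧ p (Γ.dist a b) = b ∧ IsQuasiGeodesic M A (f ∘ p) (Γ.dist a b) ∧
      ∀ i ≤ Γ.dist a b, Γ.dist a (p i) + Γ.dist (p i) b = Γ.dist a b := by
    intro a z b h
    obtain ⟨p, hp0, hpz, hpn, hp⟩ := exists_geodesic_through hΓ h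
    have hd : ∀ {i j : ℕ}, i ≤ j → j ≤ Γ.dist a b → Γ.dist (p i) (p j) = j - i := fun hij hj =>
      dist_eq_sub_of_adj hΓ hp (by rw [hp0, hpn]) hij hj
    refine ⟨p, hp0, hpz, hpn, ⟨fun i hi => hf _ _ (hp i hi), fun i hi j hj => ?_⟩,
      fun i hi => ?_⟩
    · refine le_trans ?_ (add_le_add_right (hf' (p i) (p j)) _)
      rcases le_total i j with hij | hij
      · have : (i : ℝ) ≤ j := Nat.cast_le.2 hij
        exact this.trans (le_add_of_nonneg_right (Nat.cast_nonneg _))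
      · rw [Γ.dist_comm, hd hij hi]
        exact_mod_cast (by omega)
    · have h3 := hd (Nat.zero_le i) hi
      have h4 := hd hi le_rfl
      rw [hp0] at h3
      rw [hpn] at h4
      omega
  -- a point near a geodesic of `X` between `f a` and `f c` is near a geodesic of `Γ`
  have back : ∀ a c z, gromovProduct dist (f z) (f a) (f c) ≤ D₂ + δ → ∃ q,
      Γ.dist a q + Γ.dist q c = Γ.dist a c ∧
        (Γ.dist z q : ℝ) ≤ A * (D₂ + 3 * δ + D₁) + A := by
    intro a c z h
    obtain ⟨p, hp0, -, hpn, hq, hbt⟩ := path a a c (by simp)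
    obtain ⟨γ, hγ⟩ := hgeo.exists_isSegment (f a) (f c)
    obtain ⟨t, ht, htz⟩ := hγ.exists_dist_le hX h
    obtain ⟨i, hi, hit⟩ := h₁ (f ∘ p) _ γ hq (by simpa [hp0, hpn] using hγ) t
      (by simpa [hp0, hpn] using ht)
    refine ⟨p i, hbt i hi, (hf' _ _).trans ?_⟩
    have h3 := dist_triangle_right (f z) (f (p i)) (γ t)
    simp only [Function.comp_apply] at hit
    gcongr
    linarith
  obtain ⟨N, hN⟩ := exists_nat_ge (A * (D₂ + 3 * δ + D₁) + A)
  refine ⟨_, IsSlim.isDeltaHyperbolic (D := N) hΓ fun a b c z hz => ?_⟩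
  obtain ⟨p, hp0, hpz, hpn, hq, -⟩ := path a z b hz
  obtain ⟨γ, hγ⟩ := hgeo.exists_isSegment (f a) (f b)
  have h3 := h₂ (f ∘ p) _ γ hq (by simpa [hp0, hpn] using hγ) (Γ.dist a z) (by omega)
  simp only [Function.comp_apply, hp0, hpz, hpn] at h3
  have h4 := hX.2 (f z) (f a) (f b) (f c)
  rcases min_le_iff.1 (sub_le_iff_le_add.1 (h4.trans h3)) with h5 | h5
  · obtain ⟨q, hq, hqz⟩ := back a c z h5
    exact ⟨q, by exact_mod_cast hqz.trans hN, Or.inl hq⟩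
  · obtain ⟨q, hq, hqz⟩ := back c b z h5
    exact ⟨q, by exact_mod_cast hqz.trans hN, Or.inr hq⟩

/-! ### Cayley graphs and word lengths -/

theorem connected_mulCayley {G : Type*} [Group G] {A : Set G} (hA : Subgroup.closure A = ⊤) :
    (SimpleGraph.mulCayley A).Connected := by
  have key : ∀ g : G, ∀ a, (SimpleGraph.mulCayley A).Reachable a (a * g) := fun g => by
    have hg : g ∈ Subgroup.closure A := hA ▸ Subgroup.mem_top g
    induction hg using Subgroup.closure_induction with
    | mem s hs =>
      intro a
      by_cases h : a = a * s
      · rw [← h]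
      · exact SimpleGraph.Adj.reachable
          ((SimpleGraph.mulCayley_adj A _ _).2 ⟨h, Or.inl (by simpa using hs)⟩)
    | one => simp
    | mul g h _ _ hg hh =>
      intro a
      rw [← mul_assoc]
      exact (hg a).trans (hh _)
    | inv g _ hg =>
      intro a
      simpa using (hg (a * g⁻¹)).symm
  have : Nonempty G := ⟨1⟩
  exact ⟨fun a b => by simpa using key (a⁻¹ * b) a⟩

theorem dist_mulCayley_mul_left {G : Type*} [Group G] (A : Set G) (g a b : G) :
    (SimpleGraph.mulCayley A).dist (g * a) (g * b) = (SimpleGraph.mulCayley A).dist a b := by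
  have hom : ∀ g : G, ∀ u v, (SimpleGraph.mulCayley A).edist (g * u) (g * v) ≤
      (SimpleGraph.mulCayley A).edist u v := fun g u v => by
    let φ : SimpleGraph.mulCayley A →g SimpleGraph.mulCayley A :=
      ⟨(g * ·), fun h => SimpleGraph.mulCayley_adj_mul_iff_right.2 h⟩
    by_cases h : (SimpleGraph.mulCayley A).edist u v = ⊤
    · simp [h]
    · obtain ⟨w, hw⟩ := SimpleGraph.exists_walk_of_edist_ne_top h
      rw [← hw, ← SimpleGraph.Walk.length_map φ w]
      exact SimpleGraph.edist_le _
  have h := hom g⁻¹ (g * a) (g * b)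
  simp only [inv_mul_cancel_left] at h
  rw [SimpleGraph.dist, SimpleGraph.dist, le_antisymm (hom g a b) h]

theorem dist_mulCayley_eq_one_left {G : Type*} [Group G] (A : Set G) (a b : G) :
    (SimpleGraph.mulCayley A).dist a b = (SimpleGraph.mulCayley A).dist 1 (a⁻¹ * b) := by
  rw [← dist_mulCayley_mul_left A a⁻¹ a b, inv_mul_cancel]

/-- Word lengths with respect to two relative generating sets are comparable. -/
theorem exists_dist_mulCayley_union_le {G : Type*} [Group G] {S T H : Set G} (hS : S.Finite)
    (hSH : Subgroup.closure (S ∪ H) = ⊤) (hTH : Subgroup.closure (T ∪ H) = ⊤) :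
    ∃ C : ℕ, ∀ a b : G, (SimpleGraph.mulCayley (T ∪ H)).dist a b ≤
      C * (SimpleGraph.mulCayley (S ∪ H)).dist a b := by
  have hT := connected_mulCayley hTH
  obtain ⟨C, hC⟩ := (hS.image fun s => (SimpleGraph.mulCayley (T ∪ H)).dist 1 s).bddAbove
  have hgen : ∀ s ∈ S ∪ H, (SimpleGraph.mulCayley (T ∪ H)).dist 1 s ≤ C + 1 := by
    rintro s (hs | hs)
    · exact (hC ⟨s, hs, rfl⟩).trans (Nat.le_succ _)
    · by_cases h : 1 = s
      · simp [← h]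
      · rw [SimpleGraph.dist_eq_one_iff_adj.2
          ((SimpleGraph.mulCayley_adj _ _ _).2 ⟨h, Or.inl (by simp [hs])⟩)]
        omega
  have hadj : ∀ a b, (SimpleGraph.mulCayley (S ∪ H)).Adj a b →
      (SimpleGraph.mulCayley (T ∪ H)).dist a b ≤ C + 1 := fun a b h => by
    rcases ((SimpleGraph.mulCayley_adj _ _ _).1 h).2 with h | h
    · rw [dist_mulCayley_eq_one_left]
      exact hgen _ h
    · rw [SimpleGraph.dist_comm, dist_mulCayley_eq_one_left]
      exact hgen _ h
  refine ⟨C + 1, fun a b => ?_⟩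
  obtain ⟨w, hw⟩ := (connected_mulCayley hSH).exists_walk_length_eq_dist a b
  rw [← hw]
  clear hw
  induction w with
  | nil => simp
  | @cons u v c h p ih =>
    rw [SimpleGraph.Walk.length_cons, mul_add, mul_one, add_comm]
    exact hT.dist_triangle.trans (add_le_add (hadj _ _ h) ih)

theorem dist_inv_smul_left {G X : Type*} [Group G] [PseudoMetricSpace X] [MulAction G X]
    [IsIsometricSMul G X] (g : G) (y z : X) : dist (g⁻¹ • y) z = dist y (g • z) := by
  rw [← dist_smul g, smul_inv_smul]

theorem dist_inv_mul_smul {G X : Type*} [Group G] [PseudoMetricSpace X] [MulAction G X]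
    [IsIsometricSMul G X] (a b : G) (x : X) :
    dist x ((a⁻¹ * b) • x) = dist (a • x) (b • x) := by
  rw [mul_smul, dist_comm, dist_inv_smul_left, dist_comm]

theorem exists_dist_smul_le_of_adj {G X : Type*} [Group G] [MetricSpace X] [MulAction G X]
    [IsIsometricSMul G X] {T : Set G} (hT : T.Finite) (x : X) :
    ∃ M : ℝ, 0 ≤ M ∧ ∀ a b : G,
      (SimpleGraph.mulCayley (T ∪ (MulAction.stabilizer G x : Set G))).Adj a b →
        dist (a • x) (b • x) ≤ M := by
  obtain ⟨M, hM⟩ := (hT.image fun s => dist x (s • x)).bddAbove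
  have hgen : ∀ s ∈ T ∪ (MulAction.stabilizer G x : Set G), dist x (s • x) ≤ max M 0 := by
    rintro s (hs | hs)
    · exact (hM ⟨s, hs, rfl⟩).trans (le_max_left _ _)
    · rw [MulAction.mem_stabilizer_iff.1 hs, dist_self]
      exact le_max_right _ _
  refine ⟨max M 0, le_max_right _ _, fun a b h => ?_⟩
  rcases ((SimpleGraph.mulCayley_adj _ _ _).1 h).2 with h | h
  · exact dist_inv_mul_smul a b x ▸ hgen _ h
  · exact dist_comm (a • x) _ ▸ dist_inv_mul_smul b a x ▸ hgen _ h

/-! ### Regular actions -/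

theorem exists_abs_sub_le_of_abs_sub_succ_le {τ : ℕ → ℝ} {n : ℕ} {t M : ℝ}
    (hτ : ∀ i < n, |τ i - τ (i + 1)| ≤ M) (hM : 0 ≤ M) (h0 : τ 0 ≤ t) (hn : t ≤ τ n) :
    ∃ i ≤ n, |τ i - t| ≤ M := by
  induction n with
  | zero =>
    refine ⟨0, le_rfl, ?_⟩
    rwa [le_antisymm h0 hn, sub_self, abs_zero]
  | succ n ih =>
    rcases le_or_gt t (τ n) with h | h
    · obtain ⟨i, hi, h⟩ := ih (fun i hi => hτ i (by omega)) h
      exact ⟨i, by omega, h⟩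
    · refine ⟨n + 1, le_rfl, ?_⟩
      have := hτ n (Nat.lt_succ_self n)
      rw [abs_le] at this ⊢
      constructor <;> linarith

/-- The segments from `x` to the points of its orbit stay near the orbit. As `h` runs along an edge
path from `1` to `g`, the projections of `h x` to the segment `[x, g x]` move in bounded steps, and
regularity, applied to `g` and `h`, provides an orbit point near each of them. -/
theorem exists_dist_smul_segment_le {G X : Type*} [Group G] [MetricSpace X] [MulAction G X]
    [IsIsometricSMul G X] {S : Set G} (hS : S.Finite) (hSgen : Subgroup.closure S = ⊤)
    {δ : ℝ} (hX : IsDeltaHyperbolic (dist : X → X → ℝ) δ) {x : X} {k : ℕ}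
    (hreg : RegularR2 G δ x k) :
    ∃ E : ℝ, 0 ≤ E ∧ ∀ (g : G) (γ : ℝ → X), IsSegment γ x (g • x) →
      ∀ t ∈ Icc 0 (dist x (g • x)), ∃ u : G, dist (u • x) (γ t) ≤ E := by
  have hδ := hX.1
  obtain ⟨M, hM0, hM⟩ := exists_dist_smul_le_of_adj hS x
  refine ⟨k * δ + 2 * δ + M, by positivity, fun g γ hγ t ht => ?_⟩
  obtain ⟨p, hp0, -, hpn, hp⟩ := exists_geodesic_through (connected_mulCayley hSgen)
    (a := 1) (z := 1) (b := g) (by simp)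
  obtain ⟨i, -, hi⟩ := exists_abs_sub_le_of_abs_sub_succ_le
    (τ := fun i => gromovProduct dist x (g • x) (p i • x)) (t := t) (M := M) (fun i hi => by
      have h1 := hM _ _ (SimpleGraph.mulCayley_mono subset_union_left (hp i hi))
      have h2 := dist_triangle (p i • x) (p (i + 1) • x) x
      have h3 := dist_triangle_left (p (i + 1) • x) x (p i • x)
      have h4 := dist_triangle (g • x) (p i • x) (p (i + 1) • x)
      have h5 := dist_triangle_right (g • x) (p i • x) (p (i + 1) • x)
      simp only [gromovProduct, abs_le]
      constructor <;> linarith) hM0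
    (by simpa [gromovProduct, hp0] using ht.1)
    (by simpa [gromovProduct, hpn, dist_comm] using ht.2)
  set h := p i with hh
  set τ := gromovProduct dist x (g • x) (h • x) with hτ
  obtain ⟨u, hu1, hu2, -⟩ := hreg g h
  refine ⟨u, ?_⟩
  have e2 : gromovProduct dist x (g⁻¹ • x) ((g⁻¹ * h) • x) = dist x (g • x) - τ := by
    simp only [hτ, gromovProduct, mul_smul, dist_smul]
    rw [dist_inv_smul_left, dist_inv_smul_left]
    linarith [dist_comm x (h • x), dist_comm x (g • x), dist_comm (h • x) (g • x)]
  rw [dist_inv_mul_smul, e2] at hu2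
  have hτI : τ ∈ Icc 0 (dist x (g • x)) := by
    have h1 := dist_triangle (g • x) x (h • x)
    have h2 := dist_triangle (h • x) (g • x) x
    simp only [hτ, gromovProduct, mem_Icc]
    constructor <;>
      linarith [dist_comm x (h • x), dist_comm x (g • x), dist_comm (h • x) (g • x)]
  have h1 := hX.dist_le_of_between (a := x) (c := g • x) (v := γ τ) (y := u • x) (E := k * δ)
    (by rw [hγ.dist_left hτI, hγ.dist_right hτI]; ring)
    (by rw [hγ.dist_left hτI]; exact hu1) (by rw [hγ.dist_right hτI]; exact hu2)
  have h2 := dist_triangle (u • x) (γ τ) (γ t)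
  rw [hγ.dist_eq τ hτI t ht] at h2
  linarith

/-- If segments from `x` to its orbit stay near the orbit, and elements with bounded displacement
have bounded word length, then word length is bounded by an affine function of the displacement:
walk along the segment `[x, g x]` in unit steps, each time choosing a nearby orbit point. -/
theorem dist_mulCayley_le_dist_smul {G X : Type*} [Group G] [MetricSpace X] [MulAction G X]
    [IsIsometricSMul G X] {B : Set G} (hB : Subgroup.closure B = ⊤)
    (hgeo : IsGeodesicSpace X) {x : X} {E C : ℝ} (hE0 : 0 ≤ E)
    (hE : ∀ (g : G) (γ : ℝ → X), IsSegment γ x (g • x) →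
      ∀ t ∈ Icc 0 (dist x (g • x)), ∃ u : G, dist (u • x) (γ t) ≤ E)
    (hC : ∀ g : G, dist x (g • x) ≤ 2 * E + 1 → ((SimpleGraph.mulCayley B).dist 1 g : ℝ) ≤ C)
    (a b : G) :
    ((SimpleGraph.mulCayley B).dist a b : ℝ) ≤ 2 * C * dist (a • x) (b • x) + 2 * C := by
  have hconn := connected_mulCayley hB
  have hC0 : 0 ≤ C := (Nat.cast_nonneg _).trans (hC 1 (by simp; linarith))
  set g := a⁻¹ * b with hg
  have hd : dist (a • x) (b • x) = dist x (g • x) :=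
    (dist_inv_mul_smul a b x).symm
  rw [dist_mulCayley_eq_one_left, hd, ← hg]
  obtain ⟨γ, hγ⟩ := hgeo.exists_isSegment x (g • x)
  have walk : ∀ m : ℕ, ∀ t ∈ Icc 0 (dist x (g • x)), t ≤ m → ∀ u : G,
      dist (u • x) (γ t) ≤ E → ((SimpleGraph.mulCayley B).dist 1 u : ℝ) ≤ C * (m + 1) := by
    intro m
    induction m with
    | zero =>
      intro t ht htm u hu
      obtain rfl : t = 0 := le_antisymm (by simpa using htm) ht.1
      rw [hγ.left, dist_comm] at hu
      simpa using hC u (by linarith)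
    | succ m ih =>
      intro t ht htm u hu
      have hs : max (t - 1) 0 ∈ Icc 0 (dist x (g • x)) :=
        ⟨le_max_right _ _, max_le (by linarith [ht.2]) dist_nonneg⟩
      obtain ⟨v, hv⟩ := hE g γ hγ _ hs
      push_cast at htm ⊢
      have h1 := ih _ hs (max_le (by linarith) m.cast_nonneg) v hv
      have h2 : dist (γ (max (t - 1) 0)) (γ t) ≤ 1 := by
        rw [hγ.dist_eq _ hs t ht, abs_sub_comm, abs_of_nonneg]
        · linarith [le_max_left (t - 1) 0]
        · exact sub_nonneg.2 (max_le (by linarith) ht.1)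
      have h3 : dist x ((v⁻¹ * u) • x) ≤ 2 * E + 1 := by
        rw [dist_inv_mul_smul]
        have := dist_triangle4 (u • x) (γ t) (γ (max (t - 1) 0)) (v • x)
        linarith [dist_comm (u • x) (v • x), dist_comm (γ t) (γ (max (t - 1) 0)),
          dist_comm (γ (max (t - 1) 0)) (v • x)]
      have h4 := hC _ h3
      rw [← dist_mulCayley_eq_one_left] at h4
      have h5 : ((SimpleGraph.mulCayley B).dist 1 u : ℝ) ≤
          (SimpleGraph.mulCayley B).dist 1 v + (SimpleGraph.mulCayley B).dist v u := by
        exact_mod_cast hconn.dist_triangle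
      linarith
  have h1 := walk ⌈dist x (g • x)⌉₊ _ ⟨dist_nonneg, le_rfl⟩ (Nat.le_ceil _) g
    (by rw [hγ.right, dist_self]; exact hE0)
  have h2 := mul_le_mul_of_nonneg_left (Nat.ceil_lt_add_one (dist_nonneg (x := x) (y := g • x))).le
    hC0
  have h3 := mul_nonneg hC0 (dist_nonneg (x := x) (y := g • x))
  linarith

end RelHyp

theorem mainTheorem5 {G X : Type*} [Group G] [MetricSpace X] [MulAction G X] [IsIsometricSMul G X]
    (S : Set G) (hS : S.Finite) (hSgen : Subgroup.closure S = ⊤)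
    (hgeo : RelHyp.IsGeodesicSpace X)
    (δ : ℝ) (hhyp : RelHyp.IsDeltaHyperbolic (dist : X → X → ℝ) δ)
    (x : X) (hproper : RelHyp.IsProperRelativeTo S x)
    (k : ℕ) (hreg : RelHyp.RegularR2 G δ x k) :
    RelHyp.IsWeaklyHyperbolicRelativeTo G (MulAction.stabilizer G x) := by
  open RelHyp in
  have hSH : Subgroup.closure (S ∪ (MulAction.stabilizer G x : Set G)) = ⊤ :=
    top_le_iff.1 (hSgen ▸ Subgroup.closure_mono Set.subset_union_left)
  refine ⟨⟨S, hS, hSH⟩, fun T hT hTH => ?_⟩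
  obtain ⟨E, hE0, hE⟩ := exists_dist_smul_segment_le hS hSgen hhyp hreg
  obtain ⟨M, hM0, hM⟩ := exists_dist_smul_le_of_adj hT x
  obtain ⟨N, hN⟩ := exists_nat_ge (2 * E + 1)
  obtain ⟨c, R, hR⟩ := hproper.2 N
  obtain ⟨C, hC⟩ := exists_dist_mulCayley_union_le hS hSH hTH
  -- `1` has displacement `0`, so the ball around `c` may be replaced by a ball around `1`
  have hR1 := hR 1 (by simp)
  have hR0 : 0 ≤ R := (Nat.cast_nonneg _).trans hR1
  refine exists_isDeltaHyperbolic_of_quasiIsometry (connected_mulCayley hTH) hgeo hhyp (· • x) hM0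
    (A := 2 * (C * (2 * R))) (by positivity) hM
    (dist_mulCayley_le_dist_smul hTH hgeo hE0 hE fun g hg => ?_)
  have hRg := hR g (hg.trans hN)
  rw [cayleyDist] at hR1 hRg
  rw [SimpleGraph.dist_comm] at hR1
  have h1 : ((SimpleGraph.mulCayley (S ∪ (MulAction.stabilizer G x : Set G))).dist 1 g : ℝ) ≤
      2 * R := by
    refine le_trans (Nat.cast_le.2 ((connected_mulCayley hSH).dist_triangle (v := c))) ?_
    push_cast
    linarith
  refine le_trans (Nat.cast_le.2 (hC 1 g)) ?_
  push_cast
  gcongr
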